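/- Let $R$ be a unital associative (not necessarily commutative) ring in which every left ideal and every right ideal is principal. Call an element of $R$ regular if it is non-zero and is neither a left nor a right zero divisor, and let $Q(R)\supseteq R$ be the ring of fractions of $R$, obtained by inverting all regular elements. Let $a,a_1,b,b_1\in R$ with $b$ and $b_1$ regular. (i) If $ab^{-1}=a_1b_1^{-1}$ in $Q(R)$, and $a_1,b_1$ are right coprime, that is, $Ra_1+Rb_1=R$, then there exists a regular element $q\in R$ such that $a=a_1q$ and $b=b_1q$. (ii) If $b^{-1}a=b_1^{-1}a_1$ in $Q(R)$, and $a_1,b_1$ are left coprime, that is, $a_1R+b_1R=R$, then there exists a regular element $q\in R$ such that $a=qa_1$ and $b=qb_1$. -/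

import Mathlib

open scoped nonZeroDivisors

/-!
Mathlib's `IsPrincipalIdealRing R` says that every left ideal of `R` is principal; hence
`IsPrincipalIdealRing Rᵐᵒᵖ` says that every right ideal of `R` is principal.
The submonoid `R⁰` consists of the elements that are neither left nor right zero divisors.

In a nontrivial ring such elements are nonzero.

In a left and right principal ideal ring `R⁰` satisfies the Ore condition; this is proved first, so
that the ring of fractions exists.
-/

namespace PrincipalIdeal
/-- `E` is an essential left ideal: every nonzero element has a nonzero left multiple in `E`. -/
def Ess {T : Type*} [Ring T] (E : Ideal T) : Prop := ∀ x : T, x ≠ 0 → ∃ r, r * x ≠ 0 ∧ r * x ∈ E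
/-- The ring `T` is semiprime: `x T x = 0` forces `x = 0`. -/
def Semiprime (T : Type*) [Ring T] : Prop := ∀ x : T, (∀ y, x * y * x = 0) → x = 0

section
variable {T : Type*} [Ring T]

/-- The left ideal of all `t` with `t * x ∈ E`. -/
def pre (E : Ideal T) (x : T) : Ideal T := Submodule.comap (LinearMap.toSpanSingleton T T x) E

theorem mem_pre {E : Ideal T} {x t : T} : t ∈ pre E x ↔ t * x ∈ E := by
  simp [pre]

theorem Ess.pre {E : Ideal T} (hE : Ess E) (x : T) : Ess (pre E x) := by
  intro t ht
  by_cases h : t * x = 0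
  · exact ⟨1, by simpa using ht, by simp [mem_pre, h]⟩
  · obtain ⟨r, h1, h2⟩ := hE _ h
    refine ⟨r, fun h0 => h1 ?_, by rw [mem_pre, mul_assoc]; exact h2⟩
    rw [← mul_assoc, h0, zero_mul]

theorem Ess.mono {E F : Ideal T} (hE : Ess E) (h : E ≤ F) : Ess F := fun x hx =>
  let ⟨r, h1, h2⟩ := hE x hx; ⟨r, h1, h h2⟩

/-- A left Noetherian semiprime ring is left nonsingular. -/
theorem nonsing [IsNoetherianRing T] (hT : Semiprime T) {x : T} (hx : Ess (pre ⊥ x)) : x = 0 := by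
  by_contra hne
  obtain ⟨_, ⟨z, hz0, hz, rfl⟩, hmax⟩ := set_has_maximal_iff_noetherian.mpr ‹IsNoetherianRing T›
    {I : Ideal T | ∃ z : T, z ≠ 0 ∧ Ess (pre ⊥ z) ∧ pre ⊥ z = I} ⟨_, x, hne, hx, rfl⟩
  refine hz0 (hT z fun y => ?_)
  by_contra hzyz
  have hle : pre ⊥ z ≤ pre ⊥ (z * y * z) := by
    intro t ht
    rw [mem_pre, Ideal.mem_bot] at ht ⊢
    rw [← mul_assoc, ← mul_assoc, ht, zero_mul, zero_mul]
  have h := hmax _ ⟨z * y * z, hzyz, hz.mono hle, rfl⟩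
  obtain ⟨r, h1, h2⟩ := (hz.pre y) z hz0
  rw [mem_pre, mem_pre, Ideal.mem_bot] at h2
  refine h (lt_of_le_of_ne hle fun he => h1 ?_)
  have : r ∈ pre ⊥ (z * y * z) := by
    rw [mem_pre, Ideal.mem_bot, ← h2]; noncomm_ring
  rw [← he, mem_pre, Ideal.mem_bot] at this
  exact this

/-- Essential principal left ideals of a semiprime ring have regular generators. -/
theorem regular_of_ess [IsNoetherianRing T] (hT : Semiprime T) {c : T}
    (hc : Ess (Ideal.span {c})) : c ∈ T⁰ := by
  have hpow : ∀ n, Ess (Ideal.span {c ^ n}) := by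
    intro n
    induction n with
    | zero => intro x hx; exact ⟨1, by simpa using hx, by simp⟩
    | succ n ih =>
      intro y hy
      obtain ⟨r, h1, h2⟩ := hc y hy
      obtain ⟨z, hz⟩ := Ideal.mem_span_singleton'.mp h2
      by_contra! hcon
      refine h1 (nonsing hT ((ih.pre z).mono fun s hs => ?_))
      rw [mem_pre, Ideal.mem_bot]
      by_contra h0
      rw [mem_pre, Ideal.mem_span_singleton'] at hs
      obtain ⟨w, hw⟩ := hs
      refine hcon (s * r) (by rwa [mul_assoc]) (Ideal.mem_span_singleton'.mpr ⟨w, ?_⟩)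
      rw [pow_succ, ← mul_assoc, hw, mul_assoc, hz, mul_assoc]
  rw [mem_nonZeroDivisors_iff]
  constructor
  · intro y hy
    refine nonsing hT (hc.mono fun t ht => ?_)
    obtain ⟨s, rfl⟩ := Ideal.mem_span_singleton'.mp ht
    rw [mem_pre, Ideal.mem_bot, mul_assoc, hy, mul_zero]
  · intro y hy
    let f : ℕ →o Ideal T := ⟨fun n => pre ⊥ (c ^ n), monotone_nat_of_le_succ fun n t ht => by
      rw [mem_pre, Ideal.mem_bot] at ht ⊢
      rw [pow_succ, ← mul_assoc, ht, zero_mul]⟩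
    obtain ⟨n, hn⟩ := monotone_stabilizes_iff_noetherian.mpr ‹IsNoetherianRing T› f
    by_contra hy0
    obtain ⟨r, h1, h2⟩ := hpow (n + 1) y hy0
    obtain ⟨z, hz⟩ := Ideal.mem_span_singleton'.mp h2
    have h3 : z ∈ f (n + 1 + 1) := by
      change z ∈ pre ⊥ (c ^ _)
      rw [mem_pre, Ideal.mem_bot, pow_succ, ← mul_assoc, hz, mul_assoc, hy, mul_zero]
    rw [← hn (n + 1 + 1) (by omega), hn (n + 1) (by omega)] at h3
    change z ∈ pre ⊥ (c ^ _) at h3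
    rw [mem_pre, Ideal.mem_bot, hz] at h3
    exact h1 h3

/-- In a left Noetherian ring, if `b` is not a right zero divisor then `T b` is essential. -/
theorem ess_of_inj [IsNoetherianRing T] {b : T} (hb : ∀ y, y * b = 0 → y = 0) :
    Ess (Ideal.span {b}) := by
  intro y hy
  by_contra! h
  let f : (T × Ideal.span {y}) →ₗ[T] T :=
    (LinearMap.toSpanSingleton T T b).coprod (Submodule.subtype _)
  have hf : Function.Injective f := by
    rw [← LinearMap.ker_eq_bot, LinearMap.ker_eq_bot']
    rintro ⟨r, w, hw⟩ h0
    obtain ⟨s, rfl⟩ := Ideal.mem_span_singleton'.mp hw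
    simp only [f, LinearMap.coprod_apply, LinearMap.toSpanSingleton_apply, smul_eq_mul,
      Submodule.subtype_apply] at h0
    have hs : s * y = 0 := by
      by_contra hs
      refine h s hs (Ideal.mem_span_singleton'.mpr ⟨-r, ?_⟩)
      rw [neg_mul, ← eq_neg_of_add_eq_zero_right h0]
    rw [hs, add_zero] at h0
    simp [hb r h0, hs]
  have e := IsNoetherian.equivPUnitOfProdInjective f hf
  have : (⟨y, Ideal.mem_span_singleton_self y⟩ : Ideal.span {y}) = 0 :=
    e.injective (Subsingleton.elim _ _)
  exact hy (congrArg Subtype.val this)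

theorem regular_of_inj [IsNoetherianRing T] (hT : Semiprime T) {b : T}
    (hb : ∀ y, y * b = 0 → y = 0) : b ∈ T⁰ := regular_of_ess hT (ess_of_inj hb)

theorem exists_regular_of_ess [IsPrincipalIdealRing T] (hT : Semiprime T) {E : Ideal T}
    (hE : Ess E) : ∃ c ∈ E, c ∈ T⁰ := by
  obtain ⟨c, rfl⟩ := IsPrincipalIdealRing.principal E
  exact ⟨c, Submodule.mem_span_singleton_self c, regular_of_ess hT hE⟩

end

section
variable {R T : Type*} [Ring R] [Ring T] {π : R →+* T}

/-- Right multiplication on the kernel. -/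
def rmul (π : R →+* T) (b : R) : RingHom.ker π →ₗ[R] RingHom.ker π :=
  (LinearMap.toSpanSingleton R R b).restrict fun x hx => by
    rw [RingHom.mem_ker] at hx ⊢
    simp [hx]

theorem rmul_coe (b : R) (x : RingHom.ker π) : (rmul π b x : R) = x * b := rfl

theorem ker_mul [IsPrincipalIdealRing R] (hπ : Function.Surjective π) (hT : Semiprime T)
    (hnil : ∀ x, π x = 0 → IsNilpotent x) {c : R} (hc : π c ∈ T⁰) {n : R} (hn : π n = 0) :
    ∃ m, π m = 0 ∧ m * c = n := by
  have : IsPrincipalIdealRing T := .of_surjective π hπ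
  obtain ⟨e, he⟩ := IsPrincipalIdealRing.principal (Ideal.span {c} ⊔ RingHom.ker π)
  change _ = Ideal.span {e} at he
  have hce : c ∈ Ideal.span {e} :=
    he ▸ Submodule.mem_sup_left (Ideal.mem_span_singleton_self c)
  obtain ⟨c', rfl⟩ := Ideal.mem_span_singleton'.mp hce
  have hne : n ∈ Ideal.span {e} := he ▸ Submodule.mem_sup_right hn
  have hee : e ∈ Ideal.span {c' * e} ⊔ RingHom.ker π := he ▸ Ideal.mem_span_singleton_self e
  have hreg : π e ∈ T⁰ := by
    refine regular_of_ess hT ((ess_of_inj (mem_nonZeroDivisors_iff.mp hc).2).mono ?_)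
    rw [Ideal.span_singleton_le_iff_mem, map_mul]
    exact Ideal.mem_span_singleton'.mpr ⟨_, rfl⟩
  have key : ∀ x, π (x * e) = 0 → π x = 0 := fun x hx =>
    (mem_nonZeroDivisors_iff.mp hreg).2 _ (by rwa [map_mul] at hx)
  obtain ⟨m, rfl⟩ := Ideal.mem_span_singleton'.mp hne
  obtain ⟨_, hs, k, hk, hsk⟩ := Submodule.mem_sup.mp hee
  obtain ⟨s, rfl⟩ := Ideal.mem_span_singleton'.mp hs
  have h1 : π (1 - s * c') = 0 := key _ (by
    have : (1 - s * c') * e = k := by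
      rw [sub_mul, one_mul, mul_assoc]; nth_rw 1 [← hsk]; simp
    rw [this]; exact hk)
  obtain ⟨u, hu⟩ := (hnil _ h1).isUnit_one_sub
  rw [sub_sub_cancel] at hu
  have hm : π m = 0 := key _ hn
  refine ⟨m * (↑u⁻¹ * s), by rw [map_mul, hm, zero_mul], ?_⟩
  have : (↑u⁻¹ * s) * (c' * e) = e := by
    rw [← mul_assoc, mul_assoc _ s, ← hu, Units.inv_mul, one_mul]
  rw [mul_assoc, this]

theorem cancel_left [IsPrincipalIdealRing R] (hπ : Function.Surjective π) (hT : Semiprime T)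
    (hnil : ∀ x, π x = 0 → IsNilpotent x) {c : R} (hc : π c ∈ T⁰) {y : R} (hy : y * c = 0) :
    y = 0 := by
  have hs : Function.Surjective (rmul π c) := fun n => by
    obtain ⟨m, hm, h⟩ := ker_mul hπ hT hnil hc n.2
    exact ⟨⟨m, hm⟩, Subtype.ext h⟩
  have hi := IsNoetherian.injective_of_surjective_endomorphism _ hs
  have hy' : π y = 0 := (mem_nonZeroDivisors_iff.mp hc).2 _ (by rw [← map_mul, hy, map_zero])
  have : (⟨y, hy'⟩ : RingHom.ker π) = 0 := hi (Subtype.ext (by rw [rmul_coe, hy, map_zero]; rfl))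
  exact congrArg Subtype.val this

theorem Semiprime.op (hT : Semiprime T) : Semiprime Tᵐᵒᵖ := fun x hx =>
  MulOpposite.unop_injective (hT _ fun y => by
    simpa [mul_assoc] using congrArg MulOpposite.unop (hx (.op y)))

theorem op_regular {c : T} (hc : c ∈ T⁰) : MulOpposite.op c ∈ Tᵐᵒᵖ⁰ := by
  rw [mem_nonZeroDivisors_iff] at hc ⊢
  exact ⟨fun x hx => MulOpposite.unop_injective (hc.2 _ (congrArg MulOpposite.unop hx)),
    fun x hx => MulOpposite.unop_injective (hc.1 _ (congrArg MulOpposite.unop hx))⟩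

theorem op_surj (hπ : Function.Surjective π) : Function.Surjective (RingHom.op π) := fun x =>
  let ⟨y, hy⟩ := hπ x.unop
  ⟨.op y, MulOpposite.unop_injective hy⟩

theorem op_nil (hnil : ∀ x, π x = 0 → IsNilpotent x) :
    ∀ x, RingHom.op π x = 0 → IsNilpotent x := fun x hx =>
  let ⟨n, hn⟩ := hnil x.unop (congrArg MulOpposite.unop hx)
  ⟨n, MulOpposite.unop_injective (by simpa using hn)⟩

theorem ker_mul' [IsPrincipalIdealRing Rᵐᵒᵖ] (hπ : Function.Surjective π) (hT : Semiprime T)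
    (hnil : ∀ x, π x = 0 → IsNilpotent x) {c : R} (hc : π c ∈ T⁰) {n : R} (hn : π n = 0) :
    ∃ m, π m = 0 ∧ c * m = n := by
  obtain ⟨m, h1, h2⟩ := ker_mul (op_surj hπ) hT.op (op_nil hnil) (c := .op c) (n := .op n)
    (op_regular hc) (MulOpposite.unop_injective hn)
  exact ⟨m.unop, congrArg MulOpposite.unop h1, congrArg MulOpposite.unop h2⟩

theorem cancel_right [IsPrincipalIdealRing Rᵐᵒᵖ] (hπ : Function.Surjective π) (hT : Semiprime T)
    (hnil : ∀ x, π x = 0 → IsNilpotent x) {c : R} (hc : π c ∈ T⁰) {y : R} (hy : c * y = 0) :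
    y = 0 :=
  MulOpposite.op_injective (cancel_left (op_surj hπ) hT.op (op_nil hnil) (c := .op c)
    (op_regular hc) (MulOpposite.unop_injective hy))

theorem exists_inv [IsPrincipalIdealRing R] [IsPrincipalIdealRing Rᵐᵒᵖ]
    (hπ : Function.Surjective π) (hT : Semiprime T)
    (hnil : ∀ x, π x = 0 → IsNilpotent x) {c : R} (hc : π c ∈ T⁰) :
    ∃ r : R, ∀ n, π n = 0 → r * (c * n) = n := by
  obtain ⟨p, hp⟩ := IsPrincipalIdealRing.principal (RingHom.ker (RingHom.op π))
  change _ = Ideal.span {p} at hp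
  have hp0 : π p.unop = 0 := congrArg MulOpposite.unop
    (show p ∈ RingHom.ker (RingHom.op π) from hp ▸ Ideal.mem_span_singleton_self p)
  have hgen : ∀ n, π n = 0 → ∃ t, p.unop * t = n := fun n hn => by
    have : MulOpposite.op n ∈ Ideal.span {p} := by
      rw [← hp]; exact MulOpposite.unop_injective hn
    obtain ⟨t, ht⟩ := Ideal.mem_span_singleton'.mp this
    exact ⟨t.unop, congrArg MulOpposite.unop ht⟩
  have hex : ∀ x : RingHom.ker π, ∃ y : RingHom.ker π, c * (y : R) = x := fun x =>
    let ⟨m, h1, h2⟩ := ker_mul' hπ hT hnil hc x.2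
    ⟨⟨m, h1⟩, h2⟩
  choose g hg using hex
  let q : ℕ → RingHom.ker π := fun k => g^[k] ⟨p.unop, hp0⟩
  have hq : ∀ k, c * (q (k + 1) : R) = q k := fun k => by
    simp only [q, Function.iterate_succ_apply', hg]
  have hqgen : ∀ k n, π n = 0 → ∃ t, (q k : R) * t = n := by
    intro k
    induction k with
    | zero => exact hgen
    | succ k ih =>
      intro n hn
      obtain ⟨t, ht⟩ := ih (c * n) (by rw [map_mul, hn, mul_zero])
      refine ⟨t, sub_eq_zero.mp (cancel_right hπ hT hnil hc ?_)⟩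
      rw [mul_sub, ← mul_assoc, hq, ht, sub_self]
  let f : ℕ →o Ideal R := ⟨fun k => Ideal.span {(q k : R)}, monotone_nat_of_le_succ fun k => by
    rw [Ideal.span_singleton_le_iff_mem]
    exact Ideal.mem_span_singleton'.mpr ⟨c, hq k⟩⟩
  obtain ⟨k, hk⟩ := monotone_stabilizes_iff_noetherian.mpr (inferInstance : IsNoetherianRing R) f
  have h1 : (q (k + 1) : R) ∈ f k := by
    rw [hk (k + 1) (by omega)]; exact Ideal.mem_span_singleton_self _
  obtain ⟨r, hr⟩ := Ideal.mem_span_singleton'.mp h1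
  refine ⟨r, fun n hn => ?_⟩
  obtain ⟨t, rfl⟩ := hqgen (k + 1) n hn
  rw [← mul_assoc c, hq, ← mul_assoc, hr]

end

section
universe u
variable {R T : Type*} [Ring R] [Ring T] {π : R →+* T}

theorem semisimple_of_inv [IsPrincipalIdealRing T] (hT : Semiprime T)
    (hπ : Function.Surjective π) (M : Type*) [AddCommGroup M] [Module R M] [IsNoetherian R M]
    (hM : ∀ c, π c ∈ T⁰ → ∃ r : R, ∀ m : M, r • c • m = m)
    (h0 : RingHom.ker π ≤ Module.annihilator R M) : IsSemisimpleModule R M := by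
  have hE : ∀ E : Submodule R M, (∀ m ≠ 0, ∃ r : R, r • m ≠ 0 ∧ r • m ∈ E) → E = ⊤ := by
    intro E hE
    refine eq_top_iff.mpr fun m _ => ?_
    let J : Ideal R := E.comap (LinearMap.toSpanSingleton R M m)
    have hJ : ∀ t, t ∈ J ↔ t • m ∈ E := fun t => Iff.rfl
    have hess : Ess (J.map π) := by
      intro x hx
      obtain ⟨t, rfl⟩ := hπ x
      by_cases htm : t • m = 0
      · exact ⟨1, by simpa using hx, by
          rw [one_mul]; exact Ideal.mem_map_of_mem _ ((hJ t).2 (by rw [htm]; exact E.zero_mem))⟩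
      · obtain ⟨r, h1, h2⟩ := hE _ htm
        rw [← mul_smul] at h1 h2
        refine ⟨π r, fun h => h1 ?_, by rw [← map_mul]; exact Ideal.mem_map_of_mem _ ((hJ _).2 h2)⟩
        rw [← map_mul] at h
        exact Module.mem_annihilator.mp (h0 h) m
    obtain ⟨c', hc', hreg⟩ := exists_regular_of_ess hT hess
    obtain ⟨c, hc, rfl⟩ := (Ideal.mem_map_iff_of_surjective π hπ).mp hc'
    obtain ⟨r, hr⟩ := hM c hreg
    rw [← hr m]
    exact E.smul_mem _ hc
  refine { exists_isCompl := fun P => ?_ }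
  obtain ⟨K, hK, hmax⟩ := set_has_maximal_iff_noetherian.mpr ‹IsNoetherian R M›
    {K : Submodule R M | Disjoint P K} ⟨⊥, disjoint_bot_right⟩
  refine ⟨K, hK, codisjoint_iff.mpr (hE _ fun m hm => ?_)⟩
  by_contra! h
  have hd : Disjoint (P ⊔ K) (Submodule.span R {m}) := by
    rw [Submodule.disjoint_def]
    intro x hx hxm
    obtain ⟨r, rfl⟩ := Submodule.mem_span_singleton.mp hxm
    by_contra h1
    exact h r h1 hx
  have hd2 : Disjoint P (K ⊔ Submodule.span R {m}) := hK.disjoint_sup_right_of_disjoint_sup_left hd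
  refine hmax _ hd2 (lt_of_le_of_ne le_sup_left fun he => hm ?_)
  have : m ∈ P ⊔ K := Submodule.mem_sup_right (he ▸ Submodule.mem_sup_right
    (Submodule.mem_span_singleton_self m))
  exact Submodule.disjoint_def.mp hd m this (Submodule.mem_span_singleton_self m)

theorem artinian_of_inv [IsPrincipalIdealRing T] (hT : Semiprime T)
    (hπ : Function.Surjective π) (k : ℕ) (M : Type u) [AddCommGroup M] [Module R M]
    [IsNoetherian R M]
    (hM : ∀ c, π c ∈ T⁰ → ∃ r : R, ∀ m : M, r • c • m = m)
    (h0 : RingHom.ker π ^ k ≤ Module.annihilator R M) : IsArtinian R M := by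
  induction k generalizing M with
  | zero =>
    rw [Submodule.pow_zero, Ideal.one_eq_top] at h0
    have : Subsingleton M := ⟨fun x y => by
      rw [← one_smul R x, ← one_smul R y, Module.mem_annihilator.mp (h0 trivial) x,
        Module.mem_annihilator.mp (h0 trivial) y]⟩
    infer_instance
  | succ k ih =>
    let N : Submodule R M := RingHom.ker π • ⊤
    refine (isArtinian_iff_submodule_quotient N).mpr ⟨ih N (fun c hc => ?_) ?_, ?_⟩
    · obtain ⟨r, hr⟩ := hM c hc
      exact ⟨r, fun m => Subtype.ext (hr m)⟩
    · rwa [← Submodule.annihilator_top, Submodule.le_annihilator_iff, Submodule.pow_succ,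
        Submodule.mul_smul, ← Submodule.le_annihilator_iff] at h0
    · have : IsSemisimpleModule R (M ⧸ N) := semisimple_of_inv hT hπ (M ⧸ N) (fun c hc => by
          obtain ⟨r, hr⟩ := hM c hc
          refine ⟨r, fun m => ?_⟩
          obtain ⟨m, rfl⟩ := Submodule.Quotient.mk_surjective N m
          rw [← Submodule.Quotient.mk_smul, ← Submodule.Quotient.mk_smul, hr]) (by
          rw [← SetLike.coe_subset_coe, ← Module.isTorsionBySet_iff_subset_annihilator,
            Module.isTorsionBySet_quotient_iff]
          exact fun m i hi => Submodule.smul_mem_smul hi trivial)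
      exact (IsSemisimpleModule.finite_tfae.out 1 2).mp (inferInstance : IsNoetherian R (M ⧸ N))

theorem regular_map [IsPrincipalIdealRing R] [IsPrincipalIdealRing Rᵐᵒᵖ]
    (hπ : Function.Surjective π) (hT : Semiprime T) (hN : IsNilpotent (RingHom.ker π))
    {b : R} (hb : ∀ y, y * b = 0 → y = 0) :
    π b ∈ T⁰ ∧ ∀ n, π n = 0 → ∃ m, m * b = n := by
  have : IsPrincipalIdealRing T := .of_surjective π hπ
  obtain ⟨k, hk⟩ := hN
  have hnil : ∀ x, π x = 0 → IsNilpotent x := fun x hx =>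
    ⟨k, by simpa [hk] using Ideal.pow_mem_pow (show x ∈ RingHom.ker π from hx) k⟩
  have hart : IsArtinian R (RingHom.ker π) := artinian_of_inv hT hπ k _ (fun c hc => by
    obtain ⟨r, hr⟩ := exists_inv hπ hT hnil hc
    exact ⟨r, fun m => Subtype.ext (hr m m.2)⟩) (by rw [hk]; exact bot_le)
  have hs : Function.Surjective (rmul π b) := IsArtinian.surjective_of_injective_endomorphism _
    (by
      rw [← LinearMap.ker_eq_bot, LinearMap.ker_eq_bot']
      exact fun m hm => Subtype.ext (hb _ (congrArg Subtype.val hm)))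
  have hs' : ∀ n, π n = 0 → ∃ m, π m = 0 ∧ m * b = n := fun n hn =>
    let ⟨m, hm⟩ := hs ⟨n, hn⟩
    ⟨m, m.2, congrArg Subtype.val hm⟩
  refine ⟨regular_of_inj hT fun y hy => ?_, fun n hn => let ⟨m, h⟩ := hs' n hn; ⟨m, h.2⟩⟩
  obtain ⟨y, rfl⟩ := hπ y
  rw [← map_mul] at hy
  obtain ⟨m, hm, h⟩ := hs' _ hy
  rw [← sub_eq_zero.mp (hb (m - y) (by rw [sub_mul, h, sub_self])), hm]

theorem ore_of_semiprime [IsPrincipalIdealRing R] [IsPrincipalIdealRing Rᵐᵒᵖ]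
    (hπ : Function.Surjective π) (hT : Semiprime T) (hN : IsNilpotent (RingHom.ker π))
    (a : R) (b : R⁰) : ∃ (a' : R) (b' : R⁰), b' * a = a' * b := by
  have : IsPrincipalIdealRing T := .of_surjective π hπ
  obtain ⟨hb, hker⟩ := regular_map hπ hT hN (mem_nonZeroDivisors_iff.mp b.2).2
  obtain ⟨k, hk⟩ := hN
  have hnil : ∀ x, π x = 0 → IsNilpotent x := fun x hx =>
    ⟨k, by simpa [hk] using Ideal.pow_mem_pow (show x ∈ RingHom.ker π from hx) k⟩
  obtain ⟨c, hc, hreg⟩ := exists_regular_of_ess hT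
    ((ess_of_inj (mem_nonZeroDivisors_iff.mp hb).2).pre (π a))
  obtain ⟨c, rfl⟩ := hπ c
  rw [mem_pre] at hc
  obtain ⟨d, hd⟩ := Ideal.mem_span_singleton'.mp hc
  obtain ⟨d, rfl⟩ := hπ d
  obtain ⟨m, hm⟩ := hker (c * a - d * b) (by rw [map_sub, map_mul, map_mul, hd, sub_self])
  refine ⟨d + m, ⟨c, mem_nonZeroDivisors_iff.mpr ⟨fun y hy => cancel_right hπ hT hnil hreg hy,
    fun y hy => cancel_left hπ hT hnil hreg hy⟩⟩, ?_⟩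
  rw [add_mul, hm]; simp

end

section
variable (R : Type*) [Ring R]

/-- A left Noetherian ring has a nilpotent two-sided ideal with semiprime quotient. -/
theorem exists_nilradical [IsNoetherianRing R] :
    ∃ (I : Ideal R) (_ : I.IsTwoSided), IsNilpotent I ∧ Semiprime (R ⧸ I) := by
  obtain ⟨I, ⟨hI, hnil⟩, hmax⟩ := set_has_maximal_iff_noetherian.mpr ‹IsNoetherianRing R›
    {I : Ideal R | I.IsTwoSided ∧ IsNilpotent I} ⟨⊥, inferInstance, 1, by simp⟩
  refine ⟨I, hI, hnil, fun x hx => ?_⟩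
  obtain ⟨x, rfl⟩ := Ideal.Quotient.mk_surjective x
  have hx' : ∀ y, x * y * x ∈ I := fun y => by
    rw [← Ideal.Quotient.eq_zero_iff_mem]; simpa using hx (Ideal.Quotient.mk I y)
  let K : Ideal R := Ideal.span {z | ∃ t, z = x * t}
  have hK : K.IsTwoSided := ⟨fun {z} b hz => by
    induction hz using Submodule.span_induction with
    | mem z h => obtain ⟨t, rfl⟩ := h; exact Ideal.subset_span ⟨t * b, by rw [mul_assoc]⟩
    | zero => rw [zero_mul]; exact K.zero_mem
    | add y z _ _ hy hz => rw [add_mul]; exact K.add_mem hy hz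
    | smul r z _ hz => rw [smul_mul_assoc]; exact K.smul_mem r hz⟩
  have hxK : x ∈ K := Ideal.subset_span ⟨1, by simp⟩
  have hKK : K * K ≤ I := by
    rw [Ideal.mul_le]
    intro r hr s hs
    have h2 : ∀ s ∈ K, ∀ r ∈ K, r * s ∈ I := by
      intro s hs
      induction hs using Submodule.span_induction with
      | mem z h =>
        obtain ⟨t, rfl⟩ := h
        intro r hr
        induction hr using Submodule.span_induction with
        | mem z h =>
          obtain ⟨u, rfl⟩ := h
          have := hI.mul_mem_of_left t (hx' u)
          simpa [mul_assoc] using this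
        | zero => rw [zero_mul]; exact I.zero_mem
        | add y z _ _ hy hz => rw [add_mul]; exact I.add_mem hy hz
        | smul r z _ hz => rw [smul_mul_assoc]; exact I.smul_mem r hz
      | zero => intro r _; rw [mul_zero]; exact I.zero_mem
      | add y z _ _ hy hz => intro r hr; rw [mul_add]; exact I.add_mem (hy r hr) (hz r hr)
      | smul t z _ hz =>
        intro r hr
        rw [smul_eq_mul, ← mul_assoc]; exact hz _ (hK.mul_mem_of_left t hr)
    exact h2 s hs r hr
  obtain ⟨n, hn⟩ := hnil
  have hJJ : (I ⊔ K : Ideal R) * (I ⊔ K) ≤ I := by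
    rw [Ideal.sup_mul, Ideal.mul_sup, Ideal.mul_sup]
    exact sup_le (sup_le Ideal.mul_le_left Ideal.mul_le_left) (sup_le Ideal.mul_le_right hKK)
  have hpow : ∀ n : ℕ, (I ⊔ K : Ideal R) ^ (2 * n) ≤ (I : Ideal R) ^ n := by
    intro n
    induction n with
    | zero => rw [mul_zero, Submodule.pow_zero, Submodule.pow_zero]
    | succ n ih =>
      rw [show 2 * (n + 1) = 2 * n + 1 + 1 from rfl, Submodule.pow_succ, Submodule.pow_succ,
        Submodule.pow_succ, mul_assoc]
      exact Ideal.mul_mono ih hJJ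
  have hIK : Ideal.IsTwoSided (I ⊔ K : Ideal R) := ⟨fun {z} b hz => by
    obtain ⟨y, hy, w, hw, rfl⟩ := Submodule.mem_sup.mp hz
    rw [add_mul]
    exact Submodule.add_mem_sup (hI.mul_mem_of_left b hy) (hK.mul_mem_of_left b hw)⟩
  have := hmax _ ⟨hIK, 2 * n, le_bot_iff.mp ((hpow n).trans hn.le)⟩
  rw [Ideal.Quotient.eq_zero_iff_mem]
  by_contra hxI
  exact this (lt_of_le_of_ne le_sup_left fun he => hxI (he ▸ Submodule.mem_sup_right hxK))

/-- In a left and right principal ideal ring the regular elements satisfy the Ore condition. -/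
theorem left_ore [IsPrincipalIdealRing R] [IsPrincipalIdealRing Rᵐᵒᵖ] (a : R) (b : R⁰) :
    ∃ (a' : R) (b' : R⁰), b' * a = a' * b := by
  obtain ⟨I, _, hI, hT⟩ := exists_nilradical R
  exact ore_of_semiprime (π := Ideal.Quotient.mk I) Ideal.Quotient.mk_surjective hT
    (by rwa [Ideal.mk_ker]) a b

end
/-- The regular elements of a left and right principal ideal ring form an Ore set. -/
noncomputable instance oreSet (R : Type*) [Ring R] [IsPrincipalIdealRing R]
    [IsPrincipalIdealRing Rᵐᵒᵖ] : OreLocalization.OreSet R⁰ :=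
  Classical.choice (OreLocalization.nonempty_oreSet_iff.mpr
    ⟨fun r₁ r₂ s h => ⟨s, by
      have h0 : r₁ - r₂ = 0 := (mem_nonZeroDivisors_iff.mp s.2).2 _ (by
        rw [sub_mul, h, sub_self])
      rw [sub_eq_zero.mp h0]⟩, left_ore R⟩)

/-- The ring of fractions `Q(R)`: the Ore localization of `R` at its regular elements. -/
abbrev Q (R : Type*) [Ring R] [IsPrincipalIdealRing R] [IsPrincipalIdealRing Rᵐᵒᵖ] : Type _ :=
  OreLocalization R⁰ R

section
variable {R : Type*} [Ring R]

/-- The fraction `a b⁻¹` in `Q(R)`: the product of the image of `a` and of the inverse of the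
image of `b`, which is a unit of `Q(R)`. -/
noncomputable def mulInv [IsPrincipalIdealRing R] [IsPrincipalIdealRing Rᵐᵒᵖ]
    (a : R) (b : R⁰) : Q R :=
  (OreLocalization.numeratorRingHom a : Q R) * (((OreLocalization.numeratorUnit b)⁻¹ : (Q R)ˣ) : Q R)

/-- The fraction `b⁻¹ a` in `Q(R)`. -/
noncomputable def invMul [IsPrincipalIdealRing R] [IsPrincipalIdealRing Rᵐᵒᵖ]
    (b : R⁰) (a : R) : Q R :=
  (((OreLocalization.numeratorUnit b)⁻¹ : (Q R)ˣ) : Q R) * (OreLocalization.numeratorRingHom a : Q R)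

/-- `a` and `b` are right coprime: `R a + R b = R`. -/
def IsRightCoprime (a b : R) : Prop :=
  Submodule.span R {a} ⊔ Submodule.span R {b} = ⊤

/-- `a` and `b` are left coprime: `a R + b R = R`. (The `Rᵐᵒᵖ`-submodules of `R` are its right
ideals.) -/
def IsLeftCoprime (a b : R) : Prop :=
  Submodule.span Rᵐᵒᵖ {a} ⊔ Submodule.span Rᵐᵒᵖ {b} = ⊤

end

end PrincipalIdeal

/-!
Write `z = a₁ b₁⁻¹ = a b⁻¹` and `r a₁ + s b₁ = 1`. In the ring of fractions
`b₁⁻¹ b = (r a₁ + s b₁) b₁⁻¹ b = r z b + s b = r a + s b`,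
so the fraction `b₁⁻¹ b` is the image of the element `q = r a + s b` of the ring. The identities
`b = b₁ q` and `a = z b = a₁ q` hold in the ring of fractions, hence in the ring because the map
into the Ore localization at `R⁰` is injective. The image of `q` is a unit, so `q` is regular.
The second part is the mirror image.

The Ore localization enters only through that injectivity and the invertibility of regular
elements, so both computations are carried out for an arbitrary injective ring homomorphism.
-/

open scoped nonZeroDivisors

namespace PrincipalIdeal

section
variable {R S : Type*} [Ring R] [Ring S]

theorem mem_nonZeroDivisors_of_isUnit_map {f : R →+* S} (hf : Function.Injective f) {q : R}
    (hq : IsUnit (f q)) : q ∈ R⁰ := by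
  refine mem_nonZeroDivisors_iff.mpr ⟨fun y hy => ?_, fun y hy => ?_⟩ <;>
    rw [← map_eq_zero_iff f hf]
  · exact hq.mul_right_eq_zero.mp (by rw [← map_mul, hy, map_zero])
  · exact hq.mul_left_eq_zero.mp (by rw [← map_mul, hy, map_zero])

theorem exists_right_factor {f : R →+* S} (hf : Function.Injective f) {a a₁ b b₁ r s : R}
    {u u₁ : Sˣ} (hu : f b = u) (hu₁ : f b₁ = u₁)
    (h : f a * (u⁻¹ : Sˣ) = f a₁ * (u₁⁻¹ : Sˣ)) (hrs : r * a₁ + s * b₁ = 1) :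
    ∃ q ∈ R⁰, a = a₁ * q ∧ b = b₁ * q := by
  have ha : f a = f a₁ * (u₁⁻¹ : Sˣ) * u := by rw [← h, Units.inv_mul_cancel_right]
  have hq : f (r * a + s * b) = (u₁⁻¹ * u : Sˣ) := by
    have h1 : f r * f a₁ + f s * u₁ = 1 := by
      rw [← hu₁, ← map_mul, ← map_mul, ← map_add, hrs, map_one]
    calc f (r * a + s * b) = f r * (f a₁ * (u₁⁻¹ : Sˣ) * u) + f s * u := by
          rw [map_add, map_mul, map_mul, ha, hu]
      _ = (f r * f a₁ + f s * u₁) * ((u₁⁻¹ : Sˣ) * u) := by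
          rw [add_mul, mul_assoc (f s), Units.mul_inv_cancel_left]; simp only [mul_assoc]
      _ = _ := by rw [h1, one_mul, Units.val_mul]
  refine ⟨r * a + s * b, mem_nonZeroDivisors_of_isUnit_map hf (hq ▸ Units.isUnit _), hf ?_, hf ?_⟩
  · rw [map_mul, hq, ha, Units.val_mul, mul_assoc]
  · rw [map_mul, hq, hu, hu₁, Units.val_mul, Units.mul_inv_cancel_left]

theorem exists_left_factor {f : R →+* S} (hf : Function.Injective f) {a a₁ b b₁ r s : R}
    {u u₁ : Sˣ} (hu : f b = u) (hu₁ : f b₁ = u₁)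
    (h : (u⁻¹ : Sˣ) * f a = (u₁⁻¹ : Sˣ) * f a₁) (hrs : a₁ * r + b₁ * s = 1) :
    ∃ q ∈ R⁰, a = q * a₁ ∧ b = q * b₁ := by
  have ha : f a = u * ((u₁⁻¹ : Sˣ) * f a₁) := by rw [← h, Units.mul_inv_cancel_left]
  have hq : f (a * r + b * s) = (u * u₁⁻¹ : Sˣ) := by
    have h1 : f a₁ * f r + u₁ * f s = 1 := by
      rw [← hu₁, ← map_mul, ← map_mul, ← map_add, hrs, map_one]
    calc f (a * r + b * s) = u * ((u₁⁻¹ : Sˣ) * f a₁) * f r + u * f s := by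
          rw [map_add, map_mul, map_mul, ha, hu]
      _ = u * (u₁⁻¹ : Sˣ) * (f a₁ * f r + u₁ * f s) := by
          rw [mul_add, mul_assoc _ _ (u₁ * f s), Units.inv_mul_cancel_left]; simp only [mul_assoc]
      _ = _ := by rw [h1, mul_one, Units.val_mul]
  refine ⟨a * r + b * s, mem_nonZeroDivisors_of_isUnit_map hf (hq ▸ Units.isUnit _), hf ?_, hf ?_⟩
  · rw [map_mul, hq, ha, Units.val_mul, mul_assoc]
  · rw [map_mul, hq, hu, hu₁, Units.val_mul, Units.inv_mul_cancel_right]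

theorem IsRightCoprime.exists_eq_one {a b : R} (h : IsRightCoprime a b) :
    ∃ r s, r * a + s * b = 1 := by
  have h1 : (1 : R) ∈ Submodule.span R {a} ⊔ Submodule.span R {b} := h ▸ Submodule.mem_top
  obtain ⟨_, hx, _, hy, hxy⟩ := Submodule.mem_sup.mp h1
  obtain ⟨r, rfl⟩ := Submodule.mem_span_singleton.mp hx
  obtain ⟨s, rfl⟩ := Submodule.mem_span_singleton.mp hy
  exact ⟨r, s, hxy⟩

theorem IsLeftCoprime.exists_eq_one {a b : R} (h : IsLeftCoprime a b) :
    ∃ r s, a * r + b * s = 1 := by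
  have h1 : (1 : R) ∈ Submodule.span Rᵐᵒᵖ {a} ⊔ Submodule.span Rᵐᵒᵖ {b} := h ▸ Submodule.mem_top
  obtain ⟨_, hx, _, hy, hxy⟩ := Submodule.mem_sup.mp h1
  obtain ⟨r, rfl⟩ := Submodule.mem_span_singleton.mp hx
  obtain ⟨s, rfl⟩ := Submodule.mem_span_singleton.mp hy
  exact ⟨r.unop, s.unop, hxy⟩

theorem numeratorRingHom_injective [IsPrincipalIdealRing R] [IsPrincipalIdealRing Rᵐᵒᵖ] :
    Function.Injective (OreLocalization.numeratorRingHom : R →+* Q R) :=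
  OreLocalization.numeratorHom_inj inf_le_left

end

end PrincipalIdeal

open PrincipalIdeal in
theorem theorem20121122 {R : Type*} [Ring R] [IsPrincipalIdealRing R] [IsPrincipalIdealRing Rᵐᵒᵖ]
    (a a₁ : R) (b b₁ : R⁰) :
    (PrincipalIdeal.mulInv a b = PrincipalIdeal.mulInv a₁ b₁ → PrincipalIdeal.IsRightCoprime a₁ (b₁ : R) →
      ∃ q ∈ R⁰, a = a₁ * q ∧ (b : R) = b₁ * q) ∧
    (PrincipalIdeal.invMul b a = PrincipalIdeal.invMul b₁ a₁ → PrincipalIdeal.IsLeftCoprime a₁ (b₁ : R) →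
      ∃ q ∈ R⁰, a = q * a₁ ∧ (b : R) = q * b₁) := by
  refine ⟨fun h hc => ?_, fun h hc => ?_⟩
  · obtain ⟨r, s, hrs⟩ := hc.exists_eq_one
    exact exists_right_factor numeratorRingHom_injective rfl rfl h hrs
  · obtain ⟨r, s, hrs⟩ := hc.exists_eq_one
    exact exists_left_factor numeratorRingHom_injective rfl rfl h hrs
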